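/- Work in the dagger monoidal category $\mathbf{FHilb}$ of finite-dimensional complex Hilbert spaces and linear maps, with the Hilbert space tensor product, and with the adjoint $f^\dagger$ as dagger. A dagger Frobenius algebra is an object $A$ with linear maps $m\colon A\otimes A\to A$ and $u\colon \mathbb{C}\to A$ such that $m$ is associative with unit $u$ and satisfies the Frobenius law $(m\otimes 1)\circ(1\otimes m^\dagger)=m^\dagger\circ m=(1\otimes m)\circ(m^\dagger\otimes 1)$. It is symmetric when $u^\dagger\circ m\circ\sigma=u^\dagger\circ m$, where $\sigma$ is the swap map of $A\otimes A$. It is normalisable when there is a linear map $z\colon A\to A$ that is central ($m\circ(z\otimes 1)=z\circ m=m\circ(1\otimes z)$), positive definite (an isomorphism of the form $h^\dagger\circ h$), and satisfies $\mathrm{Tr}_A(m)\circ z\circ z=u^\dagger$, where $\mathrm{Tr}_A(m)\colon A\to\mathbb{C}$ is the functional $a\mapsto \mathrm{Tr}(b\mapsto m(a\otimes b))$. The Frobenius dualiser is the map $A^*\to A$, $\varphi\mapsto(\varphi\otimes 1)(m^\dagger(u(1)))$; applying it to the functional $\langle a,\cdot\rangle$ gives an element $a^\star\in A$. Theorem.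 (1) If $(A,m,u)$ is a normalisable dagger Frobenius algebra in $\mathbf{FHilb}$, then the vector space $A$ with multiplication $m$, unit $u(1)$ and involution $a\mapsto a^\star$ is a finite-dimensional $C^*$-algebra (with respect to a suitable norm). (2) Conversely, every finite-dimensional $C^*$-algebra is $*$-isomorphic to one that arises as in (1) from a normalisable dagger Frobenius algebra in $\mathbf{FHilb}$. (3) A dagger Frobenius algebra in $\mathbf{FHilb}$ is normalisable if and only if it is symmetric. -/

import Mathlib

open scoped TensorProduct

universe u

noncomputable section

/-- A dagger Frobenius algebra in the dagger monoidal category of finite-dimensional complex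
Hilbert spaces and linear maps. The tensor product carries its Hilbert space inner product, and
the dagger of a linear map is its adjoint. -/
structure DaggerFrobeniusAlgebra (A : Type u) [NormedAddCommGroup A] [InnerProductSpace ℂ A]
    [FiniteDimensional ℂ A] where
  /-- multiplication -/
  mul : A ⊗[ℂ] A →ₗ[ℂ] A
  /-- unit -/
  unit : ℂ →ₗ[ℂ] A
  assoc : mul ∘ₗ TensorProduct.map mul LinearMap.id =
    mul ∘ₗ TensorProduct.map LinearMap.id mul ∘ₗ (TensorProduct.assoc ℂ A A A).toLinearMap
  unit_left : mul ∘ₗ TensorProduct.map unit LinearMap.id = (TensorProduct.lid ℂ A).toLinearMap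
  unit_right : mul ∘ₗ TensorProduct.map LinearMap.id unit = (TensorProduct.rid ℂ A).toLinearMap
  frobenius_left :
    TensorProduct.map mul LinearMap.id ∘ₗ (TensorProduct.assoc ℂ A A A).symm.toLinearMap ∘ₗ
      TensorProduct.map LinearMap.id (LinearMap.adjoint mul) = LinearMap.adjoint mul ∘ₗ mul
  frobenius_right :
    TensorProduct.map LinearMap.id mul ∘ₗ (TensorProduct.assoc ℂ A A A).toLinearMap ∘ₗ
      TensorProduct.map (LinearMap.adjoint mul) LinearMap.id = LinearMap.adjoint mul ∘ₗ mul

/-- `z : A → A` is positive definite: it is an isomorphism of the form `h† ∘ h`. -/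
def IsPositiveDefiniteMap {A : Type u} [NormedAddCommGroup A] [InnerProductSpace ℂ A]
    [FiniteDimensional ℂ A] (z : A →ₗ[ℂ] A) : Prop :=
  Function.Bijective z ∧
    ∃ (X : Type u) (_ : NormedAddCommGroup X) (_ : InnerProductSpace ℂ X)
      (_ : FiniteDimensional ℂ X) (h : A →ₗ[ℂ] X), z = LinearMap.adjoint h ∘ₗ h

namespace DaggerFrobeniusAlgebra

variable {A : Type u} [NormedAddCommGroup A] [InnerProductSpace ℂ A] [FiniteDimensional ℂ A]

/-- The comultiplication, the dagger of the multiplication. -/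
def comul (F : DaggerFrobeniusAlgebra A) : A →ₗ[ℂ] A ⊗[ℂ] A := LinearMap.adjoint F.mul

/-- The counit, the dagger of the unit. -/
def counit (F : DaggerFrobeniusAlgebra A) : A →ₗ[ℂ] ℂ := LinearMap.adjoint F.unit

/-- The algebra is symmetric: the counit of a product is unchanged by swapping the factors. -/
def IsSymmetric (F : DaggerFrobeniusAlgebra A) : Prop :=
  F.counit ∘ₗ F.mul ∘ₗ (TensorProduct.comm ℂ A A).toLinearMap = F.counit ∘ₗ F.mul

/-- `z` is a central map for the multiplication. -/
def IsCentral (F : DaggerFrobeniusAlgebra A) (z : A →ₗ[ℂ] A) : Prop :=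
  F.mul ∘ₗ TensorProduct.map z LinearMap.id = z ∘ₗ F.mul ∧
    F.mul ∘ₗ TensorProduct.map LinearMap.id z = z ∘ₗ F.mul

/-- The partial trace of the multiplication over its second input and its output,
`a ↦ Tr (b ↦ a b)`. -/
def traceMul (F : DaggerFrobeniusAlgebra A) : A →ₗ[ℂ] ℂ :=
  LinearMap.trace ℂ A ∘ₗ TensorProduct.curry F.mul

/-- `z` is a normaliser: central, positive definite, and `Tr_A(mul) ∘ z² = counit`. -/
structure IsNormaliser (F : DaggerFrobeniusAlgebra A) (z : A →ₗ[ℂ] A) : Prop where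
  central : F.IsCentral z
  posDef : IsPositiveDefiniteMap z
  normalise : F.traceMul ∘ₗ z ∘ₗ z = F.counit

/-- The algebra is normalisable: it has a normaliser. -/
def IsNormalisable (F : DaggerFrobeniusAlgebra A) : Prop := ∃ z : A →ₗ[ℂ] A, F.IsNormaliser z

/-- The Frobenius dualiser `A* → A`, which contracts the first leg of the Frobenius cup
`comul (unit 1)` with a functional. -/
def dualiser (F : DaggerFrobeniusAlgebra A) : Module.Dual ℂ A →ₗ[ℂ] A where
  toFun φ := TensorProduct.lid ℂ A (TensorProduct.map φ LinearMap.id (F.comul (F.unit 1)))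
  map_add' φ ψ := by simp [TensorProduct.map_add_left]
  map_smul' c φ := by simp [TensorProduct.map_smul_left]

/-- The involution: the dualiser applied to the conjugate `⟪a, ·⟫` of `a`. -/
def involution (F : DaggerFrobeniusAlgebra A) (a : A) : A :=
  F.dualiser (innerSL ℂ a).toLinearMap

/-- `e` is a `*`-isomorphism from the algebra `A`, with the multiplication and involution given by
`F`, onto the C*-algebra `B`. The target need not be assumed unital: since `A` has a unit, so has
`B`, and `e` preserves it. -/
structure IsStarIso (F : DaggerFrobeniusAlgebra A) (B : Type u) [NonUnitalCStarAlgebra B]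
    (e : A → B) : Prop where
  bijective : Function.Bijective e
  map_add : ∀ a b : A, e (a + b) = e a + e b
  map_smul : ∀ (c : ℂ) (a : A), e (c • a) = c • e a
  map_mul : ∀ a b : A, e (F.mul (a ⊗ₜ[ℂ] b)) = e a * e b
  map_star : ∀ a : A, e (F.involution a) = star (e a)

/-- The vector space `A` with the multiplication, unit and involution of `F` is a (unital)
C*-algebra: there is a C*-algebra structure on the set `A` (in particular a C*-norm, in general
different from the Hilbert space norm) whose operations are all equal to the given ones, that is,
for which the identity map is a `*`-isomorphism, and whose unit is that of `F`. -/
def IsCStar (F : DaggerFrobeniusAlgebra A) : Prop :=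
  ∃ C : CStarAlgebra A,
    @IsStarIso A _ _ _ F A (@CStarAlgebra.toNonUnitalCStarAlgebra A C) (fun a => a) ∧
      F.unit 1 = C.one

end DaggerFrobeniusAlgebra

end

/-! Write L_a for left multiplication by a. The Frobenius law makes L turn the involution into the
adjoint: ⟪ab, c⟫ = ⟪b, a⋆c⟫ (`inner_lmul_left`). The unit makes L faithful, so A is a
star-subalgebra of the operators on its own Hilbert space, which gives (1).

For (3), a normaliser z writes the counit as a ↦ Tr L_{z(z a)}; traces are cyclic and z is central,
so the counit is cyclic. Conversely, write Tr L_x = counit(s x). Symmetry makes s central and L_s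
positive and injective, and z = L_s^(-1/2) is a normaliser.

For (2), the regular trace τ of a finite-dimensional C*-algebra gives the inner product τ(a* b),
which is definite because L_{a* a} has nonnegative eigenvalues and is not nilpotent unless a = 0.
Multiplications by a and a* are then adjoint on either side, which yields the Frobenius law
(`ofAdjoint`); τ is the counit and is cyclic, so (3) applies. -/

open scoped InnerProductSpace ComplexOrder

noncomputable section

/-! ### Operators on Hilbert spaces -/

/-- Contraction of the first leg of a tensor with a vector is adjoint to tensoring with it. -/
theorem inner_lid_map_innerSL {A : Type u} [NormedAddCommGroup A] [InnerProductSpace ℂ A]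
    (a b : A) (t : A ⊗[ℂ] A) :
    ⟪b, TensorProduct.lid ℂ A
      (TensorProduct.map (innerSL ℂ a).toLinearMap LinearMap.id t)⟫_ℂ = ⟪a ⊗ₜ[ℂ] b, t⟫_ℂ := by
  induction t with
  | zero => simp
  | add x y hx hy => simp only [map_add, inner_add_right, hx, hy]
  | tmul x y => simp

theorem IsPositiveDefiniteMap.of_sq {A : Type u} [NormedAddCommGroup A] [InnerProductSpace ℂ A]
    [FiniteDimensional ℂ A] {h : A →ₗ[ℂ] A} (hs : h.IsSymmetric) (hb : Function.Bijective h) :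
    IsPositiveDefiniteMap (h ∘ₗ h) := by
  refine ⟨hb.comp hb, A, inferInstance, inferInstance, inferInstance, h, ?_⟩
  rw [LinearMap.isSymmetric_iff_isSelfAdjoint] at hs
  rw [← LinearMap.star_eq_adjoint, hs.star_eq]

/-- A positive invertible operator has an inverse fourth root that commutes with everything
that commutes with the operator. -/
theorem LinearMap.IsPositive.exists_inverse_fourth_root {A : Type u} [NormedAddCommGroup A]
    [InnerProductSpace ℂ A] [FiniteDimensional ℂ A] {S : A →ₗ[ℂ] A} (hS : S.IsPositive)
    (hinj : Function.Injective S) :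
    ∃ h : A →ₗ[ℂ] A, h.IsSymmetric ∧ Function.Bijective h ∧
      (∀ x, S (h (h (h (h x)))) = x) ∧
      ∀ T : A →ₗ[ℂ] A, Commute T S → Commute T h := by
  have := FiniteDimensional.complete ℂ A
  let Φ : (A →ₗ[ℂ] A) ≃ₐ[ℂ] (A →L[ℂ] A) := Module.End.toContinuousLinearMap A
  have hpos : 0 ≤ Φ S := by
    rw [ContinuousLinearMap.nonneg_iff_isPositive, ← ContinuousLinearMap.isPositive_toLinearMap_iff]
    exact hS
  have hu : IsUnit (Φ S) := by
    have : IsUnit S := (Module.End.isUnit_iff S).2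
      ⟨hinj, LinearMap.surjective_of_injective hinj⟩
    exact this.map Φ
  -- Two square roots: the normaliser will be `h ∘ₗ h`, and its own square has to cancel `S`.
  set p := CFC.sqrt (Φ S) with hp
  set q := CFC.sqrt p with hq
  have hp0 : 0 ≤ p := CFC.sqrt_nonneg _
  have hq0 : 0 ≤ q := CFC.sqrt_nonneg _
  have hpp : p * p = Φ S := CFC.sqrt_mul_sqrt_self _ hpos
  have hqq : q * q = p := CFC.sqrt_mul_sqrt_self _ hp0
  have hqu : IsUnit q := (CFC.isUnit_sqrt_iff p hp0).2 ((CFC.isUnit_sqrt_iff _ hpos).2 hu)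
  obtain ⟨w, hw⟩ := hqu
  have hwsa : IsSelfAdjoint w := by
    apply Units.ext
    rw [Units.coe_star, hw]
    exact (IsSelfAdjoint.of_nonneg hq0).star_eq
  have hwi : IsSelfAdjoint (↑w⁻¹ : A →L[ℂ] A) := by
    have : star w⁻¹ = w⁻¹ := by rw [star_inv, hwsa.star_eq]
    rw [IsSelfAdjoint, ← Units.coe_star, this]
  refine ⟨(↑w⁻¹ : A →L[ℂ] A).toLinearMap, ?_, ?_, ?_, ?_⟩
  · exact ContinuousLinearMap.isSelfAdjoint_iff_isSymmetric.1 hwi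
  · constructor
    · intro x y hxy
      have := congrArg (fun v => (w : A →L[ℂ] A) v) hxy
      simpa [← mul_apply_eq_comp] using this
    · intro y
      refine ⟨(w : A →L[ℂ] A) y, ?_⟩
      change ((↑w⁻¹ : A →L[ℂ] A) * (w : A →L[ℂ] A)) y = y
      simp
  · intro x
    have : Φ S * (↑w⁻¹ * (↑w⁻¹ * (↑w⁻¹ * ↑w⁻¹))) = 1 := by
      rw [← hpp, ← hqq, ← hw]
      simp [mul_assoc]
    exact congrArg (fun f : A →L[ℂ] A => f x) this
  · intro T hT
    have h1 : Commute (Φ T) (Φ S) := hT.map Φ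
    -- Square roots come from the functional calculus, which preserves commutation.
    have h2 : Commute (Φ T) p := (h1.symm.cfcₙ_nnreal NNReal.sqrt).symm
    have h3 : Commute (Φ T) q := (h2.symm.cfcₙ_nnreal NNReal.sqrt).symm
    rw [← hw] at h3
    have h4 : Commute (Φ T) (↑w⁻¹ : A →L[ℂ] A) := h3.units_inv_right
    have := h4.map Φ.symm
    rwa [AlgEquiv.symm_apply_apply] at this

/-! ### The involution and the left regular representation -/

namespace DaggerFrobeniusAlgebra

section Algebra

variable {A : Type u} [NormedAddCommGroup A] [InnerProductSpace ℂ A] [FiniteDimensional ℂ A]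
  (F : DaggerFrobeniusAlgebra A)

/-- The multiplication as a bilinear map. -/
def lmul : A →ₗ[ℂ] A →ₗ[ℂ] A := TensorProduct.curry F.mul

theorem mul_tmul (a b : A) : F.mul (a ⊗ₜ[ℂ] b) = F.lmul a b := rfl

theorem lmul_assoc (a b c : A) : F.lmul (F.lmul a b) c = F.lmul a (F.lmul b c) := by
  simpa [mul_tmul] using LinearMap.congr_fun F.assoc ((a ⊗ₜ[ℂ] b) ⊗ₜ[ℂ] c)

theorem one_lmul (a : A) : F.lmul (F.unit 1) a = a := by
  simpa [mul_tmul] using LinearMap.congr_fun F.unit_left ((1 : ℂ) ⊗ₜ[ℂ] a)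

theorem lmul_one (a : A) : F.lmul a (F.unit 1) = a := by
  simpa [mul_tmul] using LinearMap.congr_fun F.unit_right (a ⊗ₜ[ℂ] (1 : ℂ))

theorem counit_apply (a : A) : F.counit a = ⟪F.unit 1, a⟫_ℂ := by
  have := LinearMap.adjoint_inner_right F.unit (1 : ℂ) a
  simpa [counit] using this

theorem inner_involution (a b : A) :
    ⟪b, F.involution a⟫_ℂ = ⟪F.lmul a b, F.unit 1⟫_ℂ := by
  change ⟪b, TensorProduct.lid ℂ A
      (TensorProduct.map (innerSL ℂ a).toLinearMap LinearMap.id (F.comul (F.unit 1)))⟫_ℂ = _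
  rw [inner_lid_map_innerSL, comul, LinearMap.adjoint_inner_right, mul_tmul]

/-- Left multiplication by the involution of `a` is the adjoint of left multiplication by `a`. -/
theorem inner_lmul_left (a b c : A) :
    ⟪F.lmul a b, c⟫_ℂ = ⟪b, F.lmul (F.involution a) c⟫_ℂ := by
  have key : ∀ t : A ⊗[ℂ] A, TensorProduct.lid ℂ A
      (TensorProduct.map (innerSL ℂ a).toLinearMap LinearMap.id
        (TensorProduct.map LinearMap.id F.mul (TensorProduct.assoc ℂ A A A (t ⊗ₜ[ℂ] c)))) =
      F.lmul (TensorProduct.lid ℂ A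
        (TensorProduct.map (innerSL ℂ a).toLinearMap LinearMap.id t)) c := by
    intro t
    induction t with
    | zero => simp
    | add x y hx hy => simp only [TensorProduct.add_tmul, map_add, hx, hy, LinearMap.add_apply]
    | tmul x y => simp [mul_tmul]
  -- At 1 ⊗ c the Frobenius law says that `comul c` is the cup with its second leg multiplied by c
  -- on the right. Contracting the first leg with ⟪a, ·⟫ then gives a⋆c.
  have h := LinearMap.congr_fun F.frobenius_right (F.unit 1 ⊗ₜ[ℂ] c)
  simp only [LinearMap.comp_apply, TensorProduct.map_tmul, LinearMap.id_apply, mul_tmul,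
    one_lmul, LinearEquiv.coe_coe] at h
  have k := key (F.comul (F.unit 1))
  rw [comul, h] at k
  change _ = F.lmul (F.involution a) c at k
  rw [← k, inner_lid_map_innerSL, LinearMap.adjoint_inner_right, mul_tmul]

theorem lmul_injective : Function.Injective F.lmul := fun a b h => by
  rw [← F.lmul_one a, h, F.lmul_one]

/-- Together with `lmul_injective`, this lets every law of the involution be inherited from the
adjoint of operators. -/
theorem lmul_involution (a : A) : F.lmul (F.involution a) = LinearMap.adjoint (F.lmul a) := by
  ext c
  refine ext_inner_left ℂ fun b => ?_
  rw [LinearMap.adjoint_inner_right, inner_lmul_left]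

theorem lmul_lmul (a b : A) : F.lmul (F.lmul a b) = F.lmul a ∘ₗ F.lmul b := by
  ext c; exact F.lmul_assoc a b c

theorem involution_involution (a : A) : F.involution (F.involution a) = a := by
  apply F.lmul_injective
  rw [lmul_involution, lmul_involution, LinearMap.adjoint_adjoint]

theorem involution_lmul (a b : A) :
    F.involution (F.lmul a b) = F.lmul (F.involution b) (F.involution a) := by
  apply F.lmul_injective
  rw [lmul_involution, lmul_lmul, lmul_lmul, LinearMap.adjoint_comp, lmul_involution,
    lmul_involution]

theorem involution_add (a b : A) :
    F.involution (a + b) = F.involution a + F.involution b := by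
  apply F.lmul_injective
  simp only [lmul_involution, map_add]

theorem involution_smul (c : ℂ) (a : A) :
    F.involution (c • a) = star c • F.involution a := by
  apply F.lmul_injective
  rw [lmul_involution, map_smul F.lmul, map_smul F.lmul, lmul_involution]
  exact LinearEquiv.map_smulₛₗ _ _ _

theorem counit_involution_lmul (a b : A) : F.counit (F.lmul (F.involution a) b) = ⟪a, b⟫_ℂ := by
  rw [counit_apply, ← inner_lmul_left, lmul_one]

/-- A copy of `A`, to carry its algebra structure and its C*-norm. -/
def Carrier (_ : DaggerFrobeniusAlgebra A) : Type u := A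

instance : AddCommGroup F.Carrier := inferInstanceAs (AddCommGroup A)

instance : Module ℂ F.Carrier := inferInstanceAs (Module ℂ A)

instance : FiniteDimensional ℂ F.Carrier := inferInstanceAs (FiniteDimensional ℂ A)

instance : Ring F.Carrier :=
  { (inferInstance : AddCommGroup F.Carrier) with
    mul := fun a b => F.lmul a b
    one := F.unit 1
    left_distrib := fun a b c => (F.lmul a).map_add b c
    right_distrib := fun a b c => LinearMap.map_add₂ F.lmul a b c
    zero_mul := fun a => LinearMap.map_zero₂ F.lmul a
    mul_zero := fun a => (F.lmul a).map_zero
    mul_assoc := F.lmul_assoc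
    one_mul := F.one_lmul
    mul_one := F.lmul_one }

instance : Algebra ℂ F.Carrier :=
  Algebra.ofModule (fun r a b => LinearMap.map_smul₂ F.lmul r a b)
    (fun r a b => (F.lmul a).map_smul r b)

instance : StarRing F.Carrier where
  star := F.involution
  star_involutive := F.involution_involution
  star_mul := F.involution_lmul
  star_add := F.involution_add

/-- The left regular representation on the Hilbert space `A`. -/
def leftRegular : F.Carrier →ₐ[ℂ] (A →L[ℂ] A) :=
  (Module.End.toContinuousLinearMap A : (A →ₗ[ℂ] A) ≃ₐ[ℂ] (A →L[ℂ] A)).toAlgHom.comp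
    (AlgHom.ofLinearMap (A := F.Carrier) (B := Module.End ℂ A) F.lmul
      (by ext a; exact F.one_lmul a) F.lmul_lmul)

theorem leftRegular_injective : Function.Injective F.leftRegular :=
  (Module.End.toContinuousLinearMap A : (A →ₗ[ℂ] A) ≃ₐ[ℂ] (A →L[ℂ] A)).injective.comp
    F.lmul_injective

theorem leftRegular_star (a : F.Carrier) :
    F.leftRegular (star a) = star (F.leftRegular a) := by
  have := FiniteDimensional.complete ℂ A
  rw [ContinuousLinearMap.star_eq_adjoint, ContinuousLinearMap.eq_adjoint_iff]
  intro x y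
  refine (F.inner_lmul_left (F.involution a) x y).trans ?_
  exact congrArg (fun b => ⟪x, F.lmul b y⟫_ℂ) (F.involution_involution a)

instance : NormedRing F.Carrier :=
  NormedRing.induced F.Carrier (A →L[ℂ] A) F.leftRegular F.leftRegular_injective

instance : NormedAlgebra ℂ F.Carrier :=
  NormedAlgebra.induced ℂ F.Carrier (A →L[ℂ] A) F.leftRegular

instance : CStarAlgebra F.Carrier where
  toCompleteSpace := FiniteDimensional.complete ℂ F.Carrier
  norm_mul_self_le a := by
    have := FiniteDimensional.complete ℂ A
    change ‖F.leftRegular a‖ * ‖F.leftRegular a‖ ≤ ‖F.leftRegular (star a * a)‖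
    rw [map_mul, leftRegular_star, CStarRing.norm_star_mul_self]
  star_smul := F.involution_smul

theorem isStarIso_carrier : F.IsStarIso F.Carrier (fun a => a) where
  bijective := Function.bijective_id
  map_add _ _ := rfl
  map_smul _ _ := rfl
  map_mul _ _ := rfl
  map_star _ := rfl

theorem isCStar : F.IsCStar :=
  ⟨(inferInstance : CStarAlgebra F.Carrier), F.isStarIso_carrier, rfl⟩

end Algebra
end DaggerFrobeniusAlgebra

/-! ### Normalisable means symmetric -/

namespace DaggerFrobeniusAlgebra

section Symmetric

variable {A : Type u} [NormedAddCommGroup A] [InnerProductSpace ℂ A] [FiniteDimensional ℂ A]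
  (F : DaggerFrobeniusAlgebra A)

theorem traceMul_apply (a : A) : F.traceMul a = LinearMap.trace ℂ A (F.lmul a) := rfl

theorem traceMul_lmul_comm (a b : A) : F.traceMul (F.lmul a b) = F.traceMul (F.lmul b a) := by
  simp only [traceMul_apply, lmul_lmul]
  exact LinearMap.trace_comp_comm' _ _

theorem isSymmetric_iff :
    F.IsSymmetric ↔ ∀ a b, F.counit (F.lmul a b) = F.counit (F.lmul b a) := by
  constructor
  · intro h a b
    simpa [mul_tmul] using LinearMap.congr_fun h (b ⊗ₜ[ℂ] a)
  · intro h
    refine TensorProduct.ext' fun a b => ?_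
    simpa [mul_tmul] using h b a

theorem isCentral_iff (z : A →ₗ[ℂ] A) :
    F.IsCentral z ↔ (∀ a b, F.lmul (z a) b = z (F.lmul a b)) ∧
      ∀ a b, F.lmul a (z b) = z (F.lmul a b) := by
  refine and_congr ⟨fun h a b => ?_, fun h => TensorProduct.ext' fun a b => ?_⟩
    ⟨fun h a b => ?_, fun h => TensorProduct.ext' fun a b => ?_⟩
  · simpa [mul_tmul] using LinearMap.congr_fun h (a ⊗ₜ[ℂ] b)
  · simpa [mul_tmul] using h a b
  · simpa [mul_tmul] using LinearMap.congr_fun h (a ⊗ₜ[ℂ] b)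
  · simpa [mul_tmul] using h a b

theorem IsNormalisable.isSymmetric {F : DaggerFrobeniusAlgebra A} (h : F.IsNormalisable) :
    F.IsSymmetric := by
  obtain ⟨z, hz⟩ := h
  obtain ⟨h1, h2⟩ := (F.isCentral_iff z).1 hz.central
  rw [isSymmetric_iff]
  intro a b
  simp only [← hz.normalise, LinearMap.comp_apply]
  -- Centrality moves both copies of z onto a, the trace swaps the factors, and centrality moves
  -- them out again.
  rw [← h1, ← h1, traceMul_lmul_comm, h2, h2]

/-- The trace of L_a† L_a is the squared Hilbert–Schmidt norm of L_a, and L is faithful. -/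
theorem traceMul_involution_lmul_self_pos {a : A} (ha : a ≠ 0) :
    0 < F.traceMul (F.lmul (F.involution a) a) := by
  let e := stdOrthonormalBasis ℂ A
  have h : F.traceMul (F.lmul (F.involution a) a) =
      ((∑ i, ‖F.lmul a (e i)‖ ^ 2 : ℝ) : ℂ) := by
    rw [traceMul_apply, LinearMap.trace_eq_sum_inner _ e]
    push_cast
    refine Finset.sum_congr rfl fun i _ => ?_
    rw [lmul_assoc, ← inner_lmul_left, inner_self_eq_norm_sq_to_K]
    rfl
  rw [h, Complex.zero_lt_real]
  refine lt_of_le_of_ne (Finset.sum_nonneg fun i _ => by positivity) fun h0 => ha ?_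
  rw [eq_comm, Finset.sum_eq_zero_iff_of_nonneg fun i _ => by positivity] at h0
  have : F.lmul a = 0 := e.toBasis.ext fun i => by simpa using h0 i (Finset.mem_univ i)
  exact F.lmul_injective (this.trans (map_zero _).symm)

theorem IsSymmetric.isNormalisable {F : DaggerFrobeniusAlgebra A} (hF : F.IsSymmetric) :
    F.IsNormalisable := by
  rw [isSymmetric_iff] at hF
  have := FiniteDimensional.complete ℂ A
  obtain ⟨c, hc⟩ : ∃ c : A, ∀ x, ⟪c, x⟫_ℂ = F.traceMul x :=
    ⟨(InnerProductSpace.toDual ℂ A).symm (LinearMap.toContinuousLinearMap F.traceMul),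
      fun x => by rw [InnerProductSpace.toDual_symm_apply]; rfl⟩
  set s := F.involution c
  have hs : ∀ x, F.traceMul x = F.counit (F.lmul s x) := fun x => by
    rw [counit_involution_lmul, hc]
  have hl : ∀ a b, ⟪a, F.lmul s b⟫_ℂ = F.traceMul (F.lmul (F.involution a) b) := fun a b => by
    rw [traceMul_lmul_comm, hs, ← lmul_assoc, hF, counit_involution_lmul]
  -- Both sides pair with a to Tr L_{a⋆b}, so s is central.
  have hr : ∀ b, F.lmul b s = F.lmul s b := fun b => ext_inner_left ℂ fun a => by
    rw [hl, hs, hF, lmul_assoc, counit_involution_lmul]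
  have hpos : (F.lmul s).IsPositive := by
    rw [LinearMap.isPositive_iff_complex]
    intro x
    rcases eq_or_ne x 0 with rfl | hx
    · simp
    have h := F.traceMul_involution_lmul_self_pos hx
    rw [← hl, Complex.pos_iff] at h
    have h' : ⟪F.lmul s x, x⟫_ℂ = ⟪x, F.lmul s x⟫_ℂ := by
      rw [← inner_conj_symm]
      exact Complex.conj_eq_iff_im.2 h.2.symm
    rw [h']
    exact ⟨Complex.ext (by simp) (by simpa using h.2), h.1.le⟩
  have hinj : Function.Injective (F.lmul s) := by
    rw [injective_iff_map_eq_zero]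
    intro x hx
    by_contra h0
    have h := F.traceMul_involution_lmul_self_pos h0
    rw [← hl, hx, inner_zero_right] at h
    exact lt_irrefl _ h
  -- Here h = L_s^(-1/4). All left multiplications (as s is central) and right multiplications (by
  -- associativity) commute with L_s, hence with h.
  obtain ⟨h, hsym, hbij, hinv, hcomm⟩ := hpos.exists_inverse_fourth_root hinj
  have hcl : ∀ a x, F.lmul a (h x) = h (F.lmul a x) := fun a x => by
    refine LinearMap.congr_fun (hcomm (F.lmul a) (LinearMap.ext fun y => ?_)).eq x
    change F.lmul a (F.lmul s y) = F.lmul s (F.lmul a y)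
    rw [← lmul_assoc, hr, lmul_assoc]
  have hcr : ∀ a x, F.lmul (h x) a = h (F.lmul x a) := fun a x => by
    refine LinearMap.congr_fun (hcomm (F.lmul.flip a) (LinearMap.ext fun y => ?_)).eq x
    exact F.lmul_assoc s y a
  refine ⟨h ∘ₗ h, (F.isCentral_iff _).2 ⟨fun a b => ?_, fun a b => ?_⟩,
    IsPositiveDefiniteMap.of_sq hsym hbij, LinearMap.ext fun x => ?_⟩
  · simp only [LinearMap.comp_apply, hcr]
  · simp only [LinearMap.comp_apply, hcl]
  · simp only [LinearMap.comp_apply, hs, hinv]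

end Symmetric

/-! ### Frobenius algebras from adjoint multiplications -/

section Construct

variable {A : Type u} [NormedAddCommGroup A] [InnerProductSpace ℂ A] [FiniteDimensional ℂ A]

/-- A bilinear associative unital multiplication on a Hilbert space, with an operation `s` such
that multiplication by `s a` is adjoint to multiplication by `a` on either side, is a dagger
Frobenius algebra. -/
def ofAdjoint (m : A →ₗ[ℂ] A →ₗ[ℂ] A) (e : A) (s : A → A)
    (assoc : ∀ a b c, m (m a b) c = m a (m b c)) (one_mul : ∀ a, m e a = a)
    (mul_one : ∀ a, m a e = a) (inner_left : ∀ a b c, ⟪m a b, c⟫_ℂ = ⟪b, m (s a) c⟫_ℂ)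
    (inner_right : ∀ a b c, ⟪m a b, c⟫_ℂ = ⟪a, m c (s b)⟫_ℂ) : DaggerFrobeniusAlgebra A where
  mul := TensorProduct.lift m
  unit := LinearMap.toSpanSingleton ℂ A e
  assoc := TensorProduct.ext_threefold fun a b c => by simp [assoc]
  unit_left := by ext a; simp [one_mul]
  unit_right := by ext a; simp [mul_one]
  frobenius_left := by
    -- Paired with c ⊗ d, both sides of the Frobenius law become ⟪cd, ab⟫.
    refine TensorProduct.ext' fun a b => TensorProduct.ext_iff_inner_left.2 fun c d => ?_
    have key : ∀ t : A ⊗[ℂ] A, ⟪c ⊗ₜ[ℂ] d, TensorProduct.map (TensorProduct.lift m) LinearMap.id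
        ((TensorProduct.assoc ℂ A A A).symm (a ⊗ₜ[ℂ] t))⟫_ℂ = ⟪m (s a) c ⊗ₜ[ℂ] d, t⟫_ℂ := by
      intro t
      induction t with
      | zero => simp
      | add x y hx hy => simp only [TensorProduct.tmul_add, map_add, inner_add_right, hx, hy]
      | tmul x y =>
        have := inner_left a x c
        rw [← inner_conj_symm, ← inner_conj_symm x, (starRingEnd ℂ).injective.eq_iff] at this
        simp [this]
    simp only [LinearMap.comp_apply, TensorProduct.map_tmul, LinearMap.id_apply,
      LinearEquiv.coe_coe, key, LinearMap.adjoint_inner_right, TensorProduct.lift.tmul]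
    rw [assoc, ← inner_conj_symm, ← inner_left, inner_conj_symm]
  frobenius_right := by
    refine TensorProduct.ext' fun a b => TensorProduct.ext_iff_inner_left.2 fun c d => ?_
    have key : ∀ t : A ⊗[ℂ] A, ⟪c ⊗ₜ[ℂ] d, TensorProduct.map LinearMap.id (TensorProduct.lift m)
        (TensorProduct.assoc ℂ A A A (t ⊗ₜ[ℂ] b))⟫_ℂ = ⟪c ⊗ₜ[ℂ] m d (s b), t⟫_ℂ := by
      intro t
      induction t with
      | zero => simp
      | add x y hx hy => simp only [TensorProduct.add_tmul, map_add, inner_add_right, hx, hy]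
      | tmul x y =>
        have := inner_right y b d
        rw [← inner_conj_symm, ← inner_conj_symm y, (starRingEnd ℂ).injective.eq_iff] at this
        simp [this]
    simp only [LinearMap.comp_apply, TensorProduct.map_tmul, LinearMap.id_apply,
      LinearEquiv.coe_coe, key, LinearMap.adjoint_inner_right, TensorProduct.lift.tmul]
    rw [← assoc, ← inner_conj_symm, ← inner_right, inner_conj_symm]

end Construct

end DaggerFrobeniusAlgebra

/-! ### Positivity of the regular trace of a C*-algebra -/

namespace NonUnitalCStarAlgebra

variable {B : Type u} [NonUnitalCStarAlgebra B]

/-- The element b* x b = μ b* b is self-adjoint, and b* b is self-adjoint and nonzero. -/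
theorem conj_eq_of_mul_eq_smul {x b : B} {μ : ℂ} (hx : IsSelfAdjoint x) (hb : b ≠ 0)
    (h : x * b = μ • b) : star μ = μ := by
  have h1 : star b * (x * b) = μ • (star b * b) := by rw [h, mul_smul_comm]
  have h2 : star (star b * (x * b)) = star b * (x * b) := by
    rw [star_mul, star_mul, star_star, hx.star_eq, mul_assoc]
  rw [h1, star_smul, star_mul, star_star] at h2
  exact smul_left_injective ℂ ((CStarRing.star_mul_self_ne_zero_iff b).2 hb) h2

/-- Here (ab)*(ab) = μ b* b. If μ were negative, μ b* b would be both nonnegative and nonpositive in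
the spectral order, hence zero. -/
theorem nonneg_of_star_mul_self_mul_eq_smul {a b : B} {μ : ℂ} (hb : b ≠ 0)
    (h : star a * a * b = μ • b) : 0 ≤ μ := by
  let _ := CStarAlgebra.spectralOrder B
  have := CStarAlgebra.spectralOrderedRing B
  have hre : star μ = μ := conj_eq_of_mul_eq_smul (IsSelfAdjoint.star_mul_self a) hb h
  obtain ⟨r, rfl⟩ : ∃ r : ℝ, (r : ℂ) = μ := ⟨μ.re, Complex.conj_eq_iff_re.1 hre⟩
  have h1 : star (a * b) * (a * b) = (r : ℂ) • (star b * b) := by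
    rw [← mul_smul_comm, ← h, star_mul]
    simp only [mul_assoc]
  rw [Complex.zero_le_real]
  by_contra! hr
  have h2 : 0 ≤ ((-r : ℝ) : ℂ) • (star b * b) := by
    have : ((-r : ℝ) : ℂ) • (star b * b) =
        star (((√(-r) : ℝ) : ℂ) • b) * (((√(-r) : ℝ) : ℂ) • b) := by
      rw [star_smul, smul_mul_smul_comm, Complex.star_def, Complex.conj_ofReal,
        ← Complex.ofReal_mul, Real.mul_self_sqrt (by linarith)]
    rw [this]
    exact star_mul_self_nonneg _
  have h3 : 0 ≤ (r : ℂ) • (star b * b) := h1 ▸ star_mul_self_nonneg _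
  have h4 : (r : ℂ) • (star b * b) = 0 := by
    refine le_antisymm ?_ h3
    rw [Complex.ofReal_neg, neg_smul] at h2
    exact neg_nonneg.1 h2
  rcases smul_eq_zero.1 h4 with h5 | h5
  · exact hr.ne (by exact_mod_cast h5)
  · exact hb ((CStarRing.star_mul_self_eq_zero_iff b).1 h5)

/-- For self-adjoint x the C*-identity gives ‖xb‖² = ‖b* x x b‖, so x(xb) = 0 forces xb = 0 and
powers of x can be peeled off. -/
theorem eq_zero_of_isNilpotent_mul {x : B} (hx : IsSelfAdjoint x)
    (h : IsNilpotent (LinearMap.mul ℂ B x : Module.End ℂ B)) : x = 0 := by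
  have step : ∀ b, x * (x * b) = 0 → x * b = 0 := fun b hb => by
    rw [← CStarRing.star_mul_self_eq_zero_iff, star_mul, hx.star_eq, mul_assoc, hb, mul_zero]
  obtain ⟨n, hn⟩ := h
  have hpow : ∀ n b, ((LinearMap.mul ℂ B x : Module.End ℂ B) ^ n) b = 0 → x * b = 0 := by
    intro n
    induction n with
    | zero => intro b hb; rw [show b = 0 from hb, mul_zero]
    | succ n ih =>
      intro b hb
      rw [pow_succ] at hb
      exact step b (ih _ hb)
  have := hpow n x (by rw [hn]; rfl)
  rw [← CStarRing.star_mul_self_eq_zero_iff, hx.star_eq, this]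

variable [FiniteDimensional ℂ B]

variable (B) in
/-- The trace of the left regular representation. -/
def regularTrace : B →ₗ[ℂ] ℂ := LinearMap.trace ℂ B ∘ₗ LinearMap.mul ℂ B

theorem regularTrace_mul_comm (a b : B) : regularTrace B (a * b) = regularTrace B (b * a) := by
  have h : ∀ a b : B, LinearMap.mul ℂ B (a * b) = LinearMap.mul ℂ B a ∘ₗ LinearMap.mul ℂ B b :=
    fun a b => LinearMap.ext fun c => mul_assoc a b c
  simp only [regularTrace, LinearMap.comp_apply, h]
  exact LinearMap.trace_comp_comm' _ _

theorem regularTrace_eq_sum (a : B) :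
    regularTrace B a = (LinearMap.mul ℂ B a).charpoly.roots.sum :=
  Module.End.trace_eq_sum_roots_charpoly_of_splits (IsAlgClosed.splits _)

theorem exists_mul_eq_smul {a : B} {μ : ℂ} (h : μ ∈ (LinearMap.mul ℂ B a).charpoly.roots) :
    ∃ b ≠ 0, a * b = μ • b := by
  obtain ⟨b, hb⟩ :=
    ((Module.End.hasEigenvalue_iff_isRoot_charpoly _ _).2
      (Polynomial.isRoot_of_mem_roots h)).exists_hasEigenvector
  exact ⟨b, hb.2, hb.apply_eq_smul⟩

theorem regularTrace_star (a : B) : regularTrace B (star a) = star (regularTrace B a) := by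
  have hsa : ∀ x : B, IsSelfAdjoint x → star (regularTrace B x) = regularTrace B x := by
    intro x hx
    rw [regularTrace_eq_sum, ← starAddEquiv_apply, map_multiset_sum]
    congr 1
    conv_rhs => rw [← Multiset.map_id (LinearMap.mul ℂ B x).charpoly.roots]
    refine Multiset.map_congr rfl fun μ hμ => ?_
    obtain ⟨b, hb, h⟩ := exists_mul_eq_smul hμ
    exact conj_eq_of_mul_eq_smul hx hb h
  have h1 := hsa _ (realPart a).2
  have h2 := hsa _ (imaginaryPart a).2
  rw [← realPart_add_I_smul_imaginaryPart a]
  simp only [star_add, star_smul, map_add, map_smul, smul_eq_mul, star_mul', h1, h2,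
    (realPart a).2.star_eq, (imaginaryPart a).2.star_eq]

theorem regularTrace_star_mul_self_nonneg (a : B) : 0 ≤ regularTrace B (star a * a) := by
  rw [regularTrace_eq_sum]
  refine Multiset.sum_nonneg fun μ hμ => ?_
  obtain ⟨b, hb, h⟩ := exists_mul_eq_smul hμ
  exact nonneg_of_star_mul_self_mul_eq_smul hb h

/-- Nonnegative eigenvalues with sum zero all vanish, so left multiplication by a* a is nilpotent.
-/
theorem eq_zero_of_regularTrace_star_mul_self {a : B} (h : regularTrace B (star a * a) = 0) :
    a = 0 := by
  rw [← CStarRing.star_mul_self_eq_zero_iff]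
  refine eq_zero_of_isNilpotent_mul (IsSelfAdjoint.star_mul_self a) ?_
  rw [regularTrace_eq_sum] at h
  have h0 := Multiset.all_zero_of_le_zero_le_of_sum_eq_zero (fun μ hμ => by
    obtain ⟨b, hb, h⟩ := exists_mul_eq_smul hμ
    exact nonneg_of_star_mul_self_mul_eq_smul hb h) h
  set f : Module.End ℂ B := LinearMap.mul ℂ B (star a * a)
  rw [LinearMap.isNilpotent_iff_charpoly]
  have hs : f.charpoly.Splits := IsAlgClosed.splits _
  have hr : f.charpoly.roots = Multiset.replicate (Module.finrank ℂ B) 0 := by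
    rw [Multiset.eq_replicate]
    exact ⟨by rw [← hs.natDegree_eq_card_roots, LinearMap.charpoly_natDegree], fun μ hμ => h0 μ hμ⟩
  rw [hs.eq_prod_roots_of_monic (LinearMap.charpoly_monic f), hr]
  simp

end NonUnitalCStarAlgebra

/-! ### The Frobenius algebra of a finite-dimensional C*-algebra -/

open NonUnitalCStarAlgebra

/-- A copy of a finite-dimensional C*-algebra, to carry the Hilbert space structure given by the
trace of the regular representation. -/
def TraceSpace (B : Type u) : Type u := B

namespace TraceSpace

variable (B : Type u) [NonUnitalCStarAlgebra B]

instance : AddCommGroup (TraceSpace B) := inferInstanceAs (AddCommGroup B)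

instance : Module ℂ (TraceSpace B) := inferInstanceAs (Module ℂ B)

variable [FiniteDimensional ℂ B]

instance : FiniteDimensional ℂ (TraceSpace B) := inferInstanceAs (FiniteDimensional ℂ B)

/-- The inner product `⟪a, b⟫ = τ (star a * b)`. -/
@[reducible]
def core : InnerProductSpace.Core ℂ (TraceSpace B) where
  inner (a b : B) := regularTrace B (star a * b)
  conj_inner_symm (a b : B) := by
    change star (regularTrace B (star b * a)) = regularTrace B (star a * b)
    rw [← regularTrace_star, star_mul, star_star]
  re_inner_nonneg (a : B) := (Complex.nonneg_iff.1 (regularTrace_star_mul_self_nonneg a)).1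
  add_left (a b c : B) := by
    change regularTrace B (star (a + b) * c) = _
    rw [star_add, add_mul, map_add]
  smul_left (a b : B) r := by
    change regularTrace B (star (r • a) * b) = _
    rw [star_smul, smul_mul_assoc, map_smul]
    rfl
  definite (a : B) h := eq_zero_of_regularTrace_star_mul_self (B := B) h

instance : NormedAddCommGroup (TraceSpace B) := (core B).toNormedAddCommGroup

instance : InnerProductSpace ℂ (TraceSpace B) := .ofCore (core B).toCore

variable {B}

/-- The multiplication of `B` on the trace space. -/
def mul : TraceSpace B →ₗ[ℂ] TraceSpace B →ₗ[ℂ] TraceSpace B := LinearMap.mul ℂ B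

variable (B) in
-- The unit is the Riesz vector e of τ: the difference d = e* a - a satisfies τ(d d*) = τ(e*(a d*))
-- - τ(a d*) = 0, so d = 0.
theorem exists_unit : ∃ e : B, (∀ a, e * a = a) ∧ ∀ a, a * e = a := by
  have := FiniteDimensional.complete ℂ (TraceSpace B)
  let φ : TraceSpace B →ₗ[ℂ] ℂ := regularTrace B
  let e : B := (InnerProductSpace.toDual ℂ (TraceSpace B)).symm φ.toContinuousLinearMap
  have he : ∀ a : B, regularTrace B (star e * a) = regularTrace B a := fun a =>
    InnerProductSpace.toDual_symm_apply (𝕜 := ℂ) (E := TraceSpace B)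
      (x := a) (y := φ.toContinuousLinearMap)
  have hl : ∀ a : B, star e * a = a := fun a => by
    rw [← sub_eq_zero]
    set d := star e * a - a with hd
    apply eq_zero_of_regularTrace_star_mul_self
    rw [regularTrace_mul_comm]
    conv_lhs => rw [hd, sub_mul, map_sub, mul_assoc, he, sub_self]
  have hr : ∀ a : B, a * e = a := fun a => by
    rw [← star_inj, star_mul, hl]
  have hse : star e = e := by rw [← hr (star e), hl]
  exact ⟨e, fun a => by rw [← hse, hl], hr⟩

variable (B) in
theorem exists_daggerFrobeniusAlgebra : ∃ F : DaggerFrobeniusAlgebra (TraceSpace B),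
    F.IsNormalisable ∧ F.IsStarIso B (fun a => a) := by
  obtain ⟨e, hl, hr⟩ := exists_unit B
  let F : DaggerFrobeniusAlgebra (TraceSpace B) :=
    DaggerFrobeniusAlgebra.ofAdjoint mul e (fun a : B => (star a : B))
      (fun a b c : B => mul_assoc a b c) hl hr
      (fun a b c : B => by
        change regularTrace B (star (a * b) * c) = regularTrace B (star b * (star a * c))
        rw [star_mul, mul_assoc])
      (fun a b c : B => by
        change regularTrace B (star (a * b) * c) = regularTrace B (star a * (c * star b))
        rw [star_mul, mul_assoc, regularTrace_mul_comm, mul_assoc])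
  have hone : F.unit 1 = e := LinearMap.toSpanSingleton_apply_one ..
  have hcounit : ∀ a : B, F.counit a = regularTrace B a := fun a => by
    refine (F.counit_apply a).trans ?_
    rw [hone]
    change regularTrace B (star e * a) = _
    have hse : star e = e := by
      rw [← hr (star e), ← star_inj, star_mul, star_star, hr]
    rw [hse, hl]
  refine ⟨F, DaggerFrobeniusAlgebra.IsSymmetric.isNormalisable ?_, Function.bijective_id,
    fun _ _ => rfl, fun _ _ => rfl, fun _ _ => rfl, fun a => ?_⟩
  · rw [DaggerFrobeniusAlgebra.isSymmetric_iff]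
    intro a b
    exact (hcounit _).trans ((regularTrace_mul_comm (B := B) a b).trans (hcounit _).symm)
  -- The involution of a pairs with b to τ((ab)* e) = τ(b* a*), which is the pairing of b with a*.
  · have key : ∀ a b : B, regularTrace B (star (a * b) * e) = regularTrace B (star b * star a) :=
      fun a b => by rw [hr, star_mul]
    refine ext_inner_left ℂ (E := TraceSpace B) fun b => ?_
    refine (F.inner_involution a b).trans ?_
    rw [hone]
    exact key a b

end TraceSpace

end

theorem mainTheorem2 :
    (∀ (A : Type u) [NormedAddCommGroup A] [InnerProductSpace ℂ A] [FiniteDimensional ℂ A]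
        (F : DaggerFrobeniusAlgebra A), F.IsNormalisable → F.IsCStar) ∧
    (∀ (B : Type u) [NonUnitalCStarAlgebra B] [FiniteDimensional ℂ B],
      ∃ (A : Type u) (_ : NormedAddCommGroup A) (_ : InnerProductSpace ℂ A)
        (_ : FiniteDimensional ℂ A) (F : DaggerFrobeniusAlgebra A),
        F.IsNormalisable ∧ ∃ e : A → B, F.IsStarIso B e) ∧
    (∀ (A : Type u) [NormedAddCommGroup A] [InnerProductSpace ℂ A] [FiniteDimensional ℂ A]
        (F : DaggerFrobeniusAlgebra A), F.IsNormalisable ↔ F.IsSymmetric) := by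
  refine ⟨fun A _ _ _ F _ => F.isCStar, fun B _ _ => ?_, fun A _ _ _ F =>
    ⟨DaggerFrobeniusAlgebra.IsNormalisable.isSymmetric,
      DaggerFrobeniusAlgebra.IsSymmetric.isNormalisable⟩⟩
  obtain ⟨F, hF, he⟩ := TraceSpace.exists_daggerFrobeniusAlgebra B
  exact ⟨TraceSpace B, inferInstance, inferInstance, inferInstance, F, hF, fun a => a, he⟩
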